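/- There is a function $r:\mathbb{N}\to\mathbb{R}$ with $r(n)=o(n)$ as $n\to\infty$ such that the following holds for every integer $n\ge 4$. Let $K$ be a complete graph of order $n$. For a labeling $c:E(K)\to\{-1,+1\}$ and a Hamiltonian cycle $C$ in $K$, let $c(C)=\sum_{e\in E(C)}c(e)$. Then the discrepancy of Hamiltonian cycles in $K$, $$\min\Big\{\max\big\{|c(C)| : C\text{ is a Hamiltonian cycle in }K\big\} : c:E(K)\to\{-1,+1\}\Big\},$$ is at least $(3-2\sqrt{2})\,n-r(n)$, where $3-2\sqrt2\approx 0.17$. In particular, for every labeling $c:E(K)\to\{-1,+1\}$ there is a Hamiltonian cycle $C$ in $K$ with $|c(C)|\ge (3-2\sqrt{2})\,n-r(n)$. -/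

import Mathlib

open Filter Asymptotics

/-- The total label `c(C) = ∑ e ∈ E(C), c(e)` of a closed walk `C` of the complete graph on `V`, with
respect to an edge labeling `c` with labels `±1` (the units of `ℤ`). Each edge of `C` is counted once. -/
def labelSum {V : Type*} [Fintype V] [DecidableEq V]
    (c : SimpleGraph.TopEdgeLabeling V ℤˣ) {a : V} (C : (⊤ : SimpleGraph V).Walk a a) : ℤ :=
  ∑ e ∈ Finset.univ.filter (fun e : (⊤ : SimpleGraph V).edgeSet => e.1 ∈ C.edges),
    (c e : ℤ)

/-- The set `{|c(C)| : C is a Hamiltonian cycle in K}`, where `K` is the complete graph on `V`. -/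
def hamiltonianAbsSums {V : Type*} [Fintype V] [DecidableEq V]
    (c : SimpleGraph.TopEdgeLabeling V ℤˣ) : Set ℤ :=
  {k | ∃ (a : V) (C : (⊤ : SimpleGraph V).Walk a a), C.IsHamiltonianCycle ∧ k = |labelSum c C|}

/-- `D` is the discrepancy of Hamiltonian cycles in the complete graph `K` on `V`, that is,
`D = min {max {|c(C)| : C is a Hamiltonian cycle in K} : c is a ±1-edge labeling of K}`,
where all the maxima and the minimum are attained. Here `M c` is the maximum belonging to `c`. -/
def IsHamiltonianDiscrepancy (V : Type*) [Fintype V] [DecidableEq V] (D : ℤ) : Prop :=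
  ∃ M : SimpleGraph.TopEdgeLabeling V ℤˣ → ℤ,
    (∀ c, IsGreatest (hamiltonianAbsSums c) (M c)) ∧ IsLeast (Set.range M) D

namespace HamiltonianDiscrepancy

open SimpleGraph

variable {V : Type*}

/-! Some monochromatic path covers about two thirds of the vertices (`exists_monochromatic_path`).
Close it up to a Hamiltonian cycle: even if all other edges have the opposite sign, the sum is at
least `n / 3 - 2` in absolute value. Since `3 - 2√2 < 1 / 3`, a constant error term suffices. For
the path, take a longest monochromatic one, in color `G`. Maximality forces many `H`-edges to the
vertices outside it, and too many outside vertices would give a longer `H`-path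
(`card_le_of_longest`). -/

/-! ### Long monochromatic paths -/

/-- A path of `H`, given by its list of vertices, whose two end vertices satisfy `P`. -/
def PathWithEnds (H : SimpleGraph V) (P : V → Prop) (Q : List V) : Prop :=
  Q.IsChain H.Adj ∧ (∃ y ∈ Q.head?, P y) ∧ ∃ y ∈ Q.getLast?, P y

lemma PathWithEnds.singleton {H : SimpleGraph V} {P : V → Prop} {z : V} (hz : P z) :
    PathWithEnds H P [z] := by
  simp [PathWithEnds, hz]

lemma PathWithEnds.reverse {H : SimpleGraph V} {P : V → Prop} {Q : List V}
    (h : PathWithEnds H P Q) : PathWithEnds H P Q.reverse := by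
  obtain ⟨h1, h2, h3⟩ := h
  refine ⟨?_, by simpa using h3, by simpa using h2⟩
  rw [List.isChain_reverse]
  exact h1.imp fun _ _ h => h.symm

/-- Two paths whose end and start vertices are adjacent to `a` can be joined through `a`. -/
lemma PathWithEnds.join {H : SimpleGraph V} {P : V → Prop} {Q₁ Q₂ : List V} {a : V}
    (h₁ : PathWithEnds H P Q₁) (h₂ : PathWithEnds H P Q₂)
    (ha₁ : ∀ y ∈ Q₁.getLast?, H.Adj a y) (ha₂ : ∀ y ∈ Q₂.head?, H.Adj a y) :
    PathWithEnds H P (Q₁ ++ a :: Q₂) := by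
  obtain ⟨h1, ⟨x, hx, hPx⟩, -⟩ := h₁
  obtain ⟨h2, -, ⟨y, hy, hPy⟩⟩ := h₂
  refine ⟨?_, ⟨x, ?_, hPx⟩, ⟨y, ?_, hPy⟩⟩
  · rw [List.isChain_append, List.isChain_cons]
    refine ⟨h1, ⟨ha₂, h2⟩, ?_⟩
    intro u hu v hv
    simp only [List.head?_cons, Option.mem_def, Option.some.injEq] at hv
    exact hv ▸ (ha₁ u hu).symm
  · simp only [Option.mem_def] at hx
    simp [List.head?_append, hx]
  · simp only [Option.mem_def] at hy
    simp [List.getLast?_append, List.getLast?_cons, hy]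

/-- If any two consecutive vertices of `X` dominate all vertices satisfying `P`, then two disjoint
paths with ends in `P` can absorb all vertices of a list `Z` of vertices in `P`, at the cost of one
vertex of `X` for each of them, provided that `X` is at least twice as long as `Z`. -/
lemma exists_pathWithEnds_absorbing [DecidableEq V] (H : SimpleGraph V) (P : V → Prop)
    (Z : List V) : ∀ (X Q₁ Q₂ : List V),
    X.IsChain (fun a b => ∀ y, P y → H.Adj a y ∨ H.Adj b y) → (∀ z ∈ Z, P z) →
    PathWithEnds H P Q₁ → PathWithEnds H P Q₂ → 2 * Z.length ≤ X.length →
    ∃ Q₁' Q₂' : List V, PathWithEnds H P Q₁' ∧ PathWithEnds H P Q₂' ∧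
      (∀ v, (Q₁' ++ Q₂').count v ≤ (Q₁ ++ Q₂ ++ Z ++ X).count v) ∧
      (Q₁' ++ Q₂').length = Q₁.length + Q₂.length + 2 * Z.length := by
  induction Z with
  | nil =>
    intro X Q₁ Q₂ _ _ h₁ h₂ _
    refine ⟨Q₁, Q₂, h₁, h₂, fun v => ?_, by simp⟩
    simp only [List.count_append]
    omega
  | cons z Z ih =>
    intro X Q₁ Q₂ hX hZ h₁ h₂ hlen
    match X, hX, hlen with
    | [], _, hlen => simp at hlen
    | [_], _, hlen => simp at hlen; omega
    | a :: b :: X, hX, hlen =>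
      have hz : P z := hZ z (by simp)
      have hab := (List.isChain_cons_cons.1 hX).1
      have hX' : X.IsChain (fun a b => ∀ y, P y → H.Adj a y ∨ H.Adj b y) :=
        (List.isChain_cons_cons.1 hX).2.tail
      have hZ' : ∀ w ∈ Z, P w := fun w hw => hZ w (by simp [hw])
      have hlen' : 2 * Z.length ≤ X.length := by simp at hlen; omega
      obtain ⟨y₁, hy₁, hP₁⟩ := h₁.2.1
      obtain ⟨y₂, hy₂, hP₂⟩ := h₂.2.1
      -- Pigeonhole: each of `y₁`, `y₂`, `z` is adjacent to `a` or `b`, so one of these two sees at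
      -- least two of the three. It serves as connector and the other is discarded, hence the factor
      -- 2 in the length hypothesis.
      have key : ∃ x, (x = a ∨ x = b) ∧ ((H.Adj x y₁ ∧ H.Adj x y₂) ∨
          (H.Adj x z ∧ H.Adj x y₁) ∨ (H.Adj x z ∧ H.Adj x y₂)) := by
        rcases hab y₁ hP₁ with h | h <;> rcases hab y₂ hP₂ with h' | h' <;>
          rcases hab z hz with h'' | h'' <;>
          first
          | exact ⟨a, Or.inl rfl, by tauto⟩
          | exact ⟨b, Or.inr rfl, by tauto⟩
      simp only [Option.mem_def] at hy₁ hy₂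
      have single : PathWithEnds H P [z] := .singleton hz
      obtain ⟨x, hx, hcase⟩ := key
      have step : ∃ R₁ R₂ : List V, PathWithEnds H P R₁ ∧ PathWithEnds H P R₂ ∧
          (R₁ ++ R₂).Perm (x :: z :: (Q₁ ++ Q₂)) := by
        rcases hcase with ⟨h, h'⟩ | ⟨h, h'⟩ | ⟨h, h'⟩
        -- The two old paths merge, and `z` alone becomes the second path.
        · refine ⟨Q₁.reverse ++ x :: Q₂, [z], h₁.reverse.join h₂ ?_ ?_, single, ?_⟩
          · simpa [hy₁] using h
          · simpa [hy₂] using h'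
          · rw [List.perm_iff_count]
            intro v
            simp only [List.count_append, List.count_cons, List.count_reverse, List.count_nil]
            omega
        · refine ⟨[z] ++ x :: Q₁, Q₂, single.join h₁ ?_ ?_, h₂, ?_⟩
          · simpa using h
          · simpa [hy₁] using h'
          · rw [List.perm_iff_count]
            intro v
            simp only [List.count_append, List.count_cons, List.count_nil]
            omega
        · refine ⟨[z] ++ x :: Q₂, Q₁, single.join h₂ ?_ ?_, h₁, ?_⟩
          · simpa using h
          · simpa [hy₂] using h'
          · rw [List.perm_iff_count]
            intro v
            simp only [List.count_append, List.count_cons, List.count_nil]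
            omega
      obtain ⟨R₁, R₂, hR₁, hR₂, hperm⟩ := step
      obtain ⟨Q₁', Q₂', g₁, g₂, hcount, hl⟩ := ih X R₁ R₂ hX' hZ' hR₁ hR₂ hlen'
      refine ⟨Q₁', Q₂', g₁, g₂, fun v => ?_, ?_⟩
      · have e := hcount v
        have e' := hperm.count_eq v
        rcases hx with rfl | rfl <;>
        · simp only [List.count_append, List.count_cons] at e e' ⊢
          omega
      · have e := hperm.length_eq
        simp only [List.length_append, List.length_cons] at e hl ⊢
        omega

/-- If the edges of a complete graph are covered by `G` and `H`, and `l` is a path of `G` that is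
a longest path in `G` and at least as long as any path of `H`, then `l` covers about two thirds of
the vertices. -/
lemma card_le_of_longest [Fintype V] [DecidableEq V] {G H : SimpleGraph V}
    (hGH : ∀ x y, x ≠ y → G.Adj x y ∨ H.Adj x y) {l : List V} (hl : l.Nodup)
    (hlG : l.IsChain G.Adj) (h2 : 2 ≤ l.length)
    (hmaxG : ∀ m : List V, m.Nodup → m.IsChain G.Adj → m.length ≤ l.length)
    (hmaxH : ∀ m : List V, m.Nodup → m.IsChain H.Adj → m.length ≤ l.length) :
    Fintype.card V ≤ l.length + l.length / 2 := by
  by_contra! hcard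
  obtain ⟨x, M, w, rfl⟩ : ∃ x M w, l = x :: (M ++ [w]) := by
    match l, h2 with
    | x :: y :: t, _ =>
      exact ⟨x, (y :: t).dropLast, (y :: t).getLast (by simp), by
        rw [List.dropLast_append_getLast]⟩
  set l := x :: (M ++ [w]) with hl_def
  have hlen : l.length = M.length + 2 := by simp [hl_def]
  have hx : ∀ y, y ∉ l → H.Adj x y := by
    intro y hy
    refine (hGH x y (fun h => hy (by simp [hl_def, h]))).resolve_left fun h => ?_
    have := hmaxG (y :: l) (List.nodup_cons.2 ⟨hy, hl⟩)
      (List.isChain_cons_cons.2 ⟨h.symm, hlG⟩)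
    simp at this
  have hw : ∀ y, y ∉ l → H.Adj w y := by
    intro y hy
    refine (hGH w y (fun h => hy (by simp [hl_def, h]))).resolve_left fun h => ?_
    have := hmaxG (l ++ [y])
      (List.nodup_append.2 ⟨hl, by simp, by
        intro a ha b hb; simp at hb; subst hb; exact fun h => hy (h ▸ ha)⟩)
      (List.isChain_append.2 ⟨hlG, by simp, by
        intro a ha b hb
        have : l.getLast? = some w := by simp [hl_def, List.getLast?_cons]
        simp_all⟩)
    simp at this
  -- Otherwise `y` could be inserted between `a` and `b`, lengthening the `G`-path.
  have hM : M.IsChain (fun a b => ∀ y, y ∉ l → H.Adj a y ∨ H.Adj b y) := by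
    rw [List.isChain_iff_forall_rel_of_append_cons_cons]
    intro a b l₁ l₂ hM y hy
    by_contra! hcon
    have hl' : l = (x :: l₁) ++ a :: b :: (l₂ ++ [w]) := by simp [hl_def, hM]
    rw [hl'] at hlG hl
    have hya : y ≠ a := fun h => hy (by simp [hl', h])
    have hyb : y ≠ b := fun h => hy (by simp [hl', h])
    have hGa : G.Adj a y := (hGH a y hya.symm).resolve_right hcon.1
    have hGb : G.Adj y b := ((hGH b y hyb.symm).resolve_right hcon.2).symm
    have hperm : ((x :: l₁) ++ a :: y :: b :: (l₂ ++ [w])).Perm (y :: l) := by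
      rw [hl', List.perm_iff_count]
      intro v
      simp only [List.count_append, List.count_cons]
      omega
    have := hmaxG ((x :: l₁) ++ a :: y :: b :: (l₂ ++ [w]))
      (hperm.nodup_iff.2 (List.nodup_cons.2 ⟨hy, hl' ▸ hl⟩)) (by
        rw [List.isChain_append_cons_cons] at hlG ⊢
        exact ⟨hlG.1, hGa, List.isChain_cons_cons.2 ⟨hGb, hlG.2.2⟩⟩)
    have e := hperm.length_eq
    simp only [List.length_cons] at e
    omega
  -- Two vertices of `Y` start the paths and the other `l.length / 2 - 1` are absorbed through `M`.
  -- Joining the results through `x` and appending `w` gives `2 * (l.length / 2) + 2 > l.length`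
  -- vertices.
  obtain ⟨Y, hYsub, hYcard⟩ : ∃ Y ⊆ l.toFinsetᶜ, Y.card = l.length / 2 + 1 := by
    refine Finset.exists_subset_card_eq ?_
    rw [Finset.card_compl, List.toFinset_card_of_nodup hl]
    omega
  have hY : ∀ y ∈ Y.toList, y ∉ l := fun y hy => by
    simpa using hYsub (Finset.mem_toList.1 hy)
  have hYlen : Y.toList.length = l.length / 2 + 1 := by simp [hYcard]
  have hYnodup := Y.nodup_toList
  generalize Y.toList = L at hY hYlen hYnodup
  match L, hY, hYlen, hYnodup with
  | [], _, h, _ => simp at h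
  | [_], _, h, _ => simp at h; omega
  | y₁ :: y₂ :: Z, hY, hYlen, hYnodup =>
    simp only [List.length_cons] at hYlen
    obtain ⟨Q₁, Q₂, h₁, h₂, hcount, hQlen⟩ := exists_pathWithEnds_absorbing H (· ∉ l) Z M [y₁] [y₂]
      hM (fun z hz => hY z (by simp [hz])) (.singleton (hY _ (by simp)))
      (.singleton (hY _ (by simp))) (by omega)
    have hall : (y₁ :: y₂ :: Z ++ l).Nodup :=
      List.nodup_append.2 ⟨hYnodup, hl, fun a ha b hb h => hY a ha (h ▸ hb)⟩
    have hjoin : PathWithEnds H (· ∉ l) (Q₁ ++ x :: Q₂) := by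
      refine h₁.join h₂ ?_ ?_
      · obtain ⟨y, hy, hP⟩ := h₁.2.2
        intro y' hy'
        obtain rfl : y = y' := by simp_all
        exact hx y hP
      · obtain ⟨y, hy, hP⟩ := h₂.2.1
        intro y' hy'
        obtain rfl : y = y' := by simp_all
        exact hx y hP
    have := hmaxH ((Q₁ ++ x :: Q₂) ++ [w]) (by
        rw [List.nodup_iff_count_le_one] at hall ⊢
        intro v
        have e := hall v
        have e' := hcount v
        simp only [hl_def, List.count_append, List.count_cons, List.count_nil] at e e' ⊢
        omega) (by
        refine List.isChain_append.2 ⟨hjoin.1, by simp, ?_⟩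
        obtain ⟨y, hy, hP⟩ := hjoin.2.2
        intro y' hy' w' hw'
        obtain rfl : y = y' := by simp_all
        obtain rfl : w = w' := by simpa using hw'
        exact (hw y hP).symm)
    simp only [List.length_append, List.length_cons, List.length_nil] at this hQlen
    omega

/-- **Gerencsér–Gyárfás**: in a 2-edge-colored complete graph there is a monochromatic path
covering about two thirds of the vertices. -/
theorem exists_monochromatic_path [Fintype V] [DecidableEq V] (c : TopEdgeLabeling V ℤˣ)
    (hV : 2 ≤ Fintype.card V) :
    ∃ (ε : ℤˣ) (l : List V), l.Nodup ∧ l.IsChain (c.labelGraph ε).Adj ∧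
      Fintype.card V ≤ l.length + l.length / 2 := by
  let S : Set ℕ := {k | ∃ (ε : ℤˣ) (l : List V), l.Nodup ∧ l.IsChain (c.labelGraph ε).Adj ∧
    l.length = k}
  have hcover : ∀ (ε : ℤˣ) (x y : V), x ≠ y →
      (c.labelGraph ε).Adj x y ∨ (c.labelGraph (-ε)).Adj x y := by
    intro ε x y hxy
    simp only [TopEdgeLabeling.labelGraph_adj]
    rcases Int.units_eq_one_or ε with rfl | rfl <;>
      rcases Int.units_eq_one_or (c.get x y hxy) with h | h
    · exact Or.inl ⟨hxy, h⟩
    · exact Or.inr ⟨hxy, h⟩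
    · exact Or.inr ⟨hxy, by simpa using h⟩
    · exact Or.inl ⟨hxy, h⟩
  have hbdd : BddAbove S := ⟨Fintype.card V, by
    rintro k ⟨ε, l, hl, -, rfl⟩
    exact hl.length_le_card⟩
  have hne : S.Nonempty := ⟨0, 1, [], by simp⟩
  obtain ⟨ε, l, hl, hchain, hlen⟩ := Nat.sSup_mem hne hbdd
  have hmax : ∀ (δ : ℤˣ) (m : List V), m.Nodup → m.IsChain (c.labelGraph δ).Adj →
      m.length ≤ l.length := fun δ m hm hm' => hlen ▸ le_csSup hbdd ⟨δ, m, hm, hm', rfl⟩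
  refine ⟨ε, l, hl, hchain, card_le_of_longest (hcover ε) hl hchain ?_ (hmax ε) (hmax (-ε))⟩
  -- Any single edge is a monochromatic path on two vertices.
  obtain ⟨x, y, hxy⟩ := Fintype.exists_pair_of_one_lt_card hV
  rcases hcover 1 x y hxy with h | h <;>
    simpa using hmax _ [x, y] (by simpa using hxy) (by simpa using h)

/-! ### From paths to Hamiltonian cycles and their label sums -/

lemma exists_walk_support_eq (G : SimpleGraph V) (u : V) (l : List V)
    (h : (u :: l).IsChain G.Adj) : ∃ (v : V) (p : G.Walk u v), p.support = u :: l := by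
  induction l generalizing u with
  | nil => exact ⟨u, .nil, rfl⟩
  | cons w l ih =>
    obtain ⟨v, p, hp⟩ := ih w h.tail
    exact ⟨v, .cons (List.isChain_cons_cons.1 h).1 p, by simp [hp]⟩

/-- Every path of a subgraph of a complete graph extends to a Hamiltonian cycle. -/
theorem exists_isHamiltonianCycle_of_isPath [Fintype V] [DecidableEq V]
    (hV : 3 ≤ Fintype.card V) {G : SimpleGraph V} {u v : V} (q : G.Walk u v) (hq : q.IsPath) :
    ∃ (a : V) (C : (⊤ : SimpleGraph V).Walk a a), C.IsHamiltonianCycle ∧ q.edges ⊆ C.edges := by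
  let rest := (q.support.toFinsetᶜ).toList
  have hrest : ∀ x ∈ rest, x ∉ q.support := fun x hx => by
    simpa [rest] using hx
  have hnodup : (v :: rest).Nodup :=
    List.nodup_cons.2 ⟨fun h => hrest v h q.end_mem_support, Finset.nodup_toList _⟩
  obtain ⟨w, r, hr⟩ := exists_walk_support_eq (⊤ : SimpleGraph V) v rest
    (List.Pairwise.isChain (hnodup.imp fun h => by simpa using h))
  let p := (q.mapLe le_top).append r
  have hsupp : p.support = q.support ++ rest := by
    simp [p, Walk.support_append, hr]
  have hpath : p.IsPath := by
    rw [Walk.isPath_def, hsupp]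
    exact List.nodup_append.2 ⟨hq.support_nodup, Finset.nodup_toList _,
      fun a ha b hb h => hrest b hb (h ▸ ha)⟩
  have hham : p.IsHamiltonian := hpath.isHamiltonian_of_mem fun x => by
    rw [hsupp]
    by_cases hx : x ∈ q.support <;> simp [rest, hx]
  have hplen := hham.length_eq
  have hwu : w ≠ u := by
    rintro rfl
    have := Walk.length_eq_zero_iff.2 (Walk.isPath_iff_nil.1 hpath)
    omega
  refine ⟨w, .cons (by simpa using hwu) p, ?_, ?_⟩
  · refine Walk.isHamiltonianCycle_isCycle_and_isHamiltonian_tail.2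
      ⟨?_, by simpa [Walk.IsHamiltonian] using hham⟩
    refine Walk.isCycle_iff_isPath_tail_and_le_length.2 ⟨by simpa using hpath, ?_⟩
    simp only [Walk.length_cons]
    omega
  · intro e he
    simp [p, Walk.edges_append, he]

lemma two_mul_length_le_abs_labelSum [Fintype V] [DecidableEq V] (c : TopEdgeLabeling V ℤˣ)
    {ε : ℤˣ} {u v a : V} (q : (c.labelGraph ε).Walk u v) (hq : q.IsPath)
    (C : (⊤ : SimpleGraph V).Walk a a) (hC : C.IsHamiltonianCycle) (hqC : q.edges ⊆ C.edges) :
    2 * (q.length : ℤ) - Fintype.card V ≤ |labelSum c C| := by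
  classical
  set E := Finset.univ.filter (fun e : (⊤ : SimpleGraph V).edgeSet => e.1 ∈ C.edges) with hE
  set F := E.filter (fun e => e.1 ∈ q.edges) with hF
  have hcard : ∀ s : List (Sym2 V), s.Nodup → s ⊆ C.edges →
      (E.filter (fun e => e.1 ∈ s)).card = s.length := by
    intro s hs hsC
    rw [← List.toFinset_card_of_nodup hs,
      ← Finset.card_map (Function.Embedding.subtype (· ∈ (⊤ : SimpleGraph V).edgeSet))]
    congr 1
    ext e
    simp only [hE, Finset.mem_map, Finset.mem_filter, Finset.mem_univ, true_and,
      Function.Embedding.subtype_apply, List.mem_toFinset]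
    constructor
    · rintro ⟨e, h, rfl⟩
      exact h.2
    · exact fun h => ⟨⟨e, C.edges_subset_edgeSet (hsC h)⟩, ⟨hsC h, h⟩, rfl⟩
  have hEcard : E.card = Fintype.card V := by
    have := hcard C.edges hC.isCycle.edges_nodup (List.Subset.refl _)
    rw [Finset.filter_true_of_mem (by simp [hE])] at this
    rw [this, Walk.length_edges, hC.length_eq]
  have hFcard : F.card = q.length := by
    rw [hF, hcard q.edges hq.isTrail.edges_nodup hqC, Walk.length_edges]
  have hlabel : ∀ e ∈ F, c e = ε := by
    rintro ⟨e, he⟩ heF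
    have h := q.edges_subset_edgeSet (Finset.mem_filter.1 heF).2
    induction e with
    | _ x y =>
      obtain ⟨hxy, h⟩ := (TopEdgeLabeling.labelGraph_adj x y).1 h
      exact h
  have hmul : ∀ δ : ℤˣ, 0 ≤ (ε : ℤ) * δ + 1 := by
    intro δ
    rcases Int.units_eq_one_or ε with rfl | rfl <;>
      rcases Int.units_eq_one_or δ with rfl | rfl <;> simp
  -- The weight `ε * c e + 1` is 2 on the path and nonnegative elsewhere.
  have hsum : 2 * (F.card : ℤ) ≤ ∑ e ∈ E, ((ε : ℤ) * c e + 1) := by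
    calc 2 * (F.card : ℤ) = ∑ e ∈ F, ((ε : ℤ) * c e + 1) := by
          rw [Finset.sum_congr rfl (g := fun _ => (2 : ℤ))]
          · simp [mul_comm]
          · intro e he
            rw [hlabel e he, ← Units.val_mul, Int.units_mul_self]
            norm_num
      _ ≤ _ := Finset.sum_le_sum_of_subset_of_nonneg (Finset.filter_subset _ _)
          fun e _ _ => hmul _
  rw [Finset.sum_add_distrib, ← Finset.mul_sum] at hsum
  have habs : (ε : ℤ) * labelSum c C ≤ |labelSum c C| := by
    rcases Int.units_eq_one_or ε with rfl | rfl
    · simpa using le_abs_self _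
    · simpa using neg_le_abs _
  have hdef : labelSum c C = ∑ e ∈ E, (c e : ℤ) := rfl
  rw [← hdef] at hsum
  simp only [Finset.sum_const, hEcard, hFcard, nsmul_eq_mul, mul_one] at hsum
  linarith

theorem exists_card_le_hamiltonianAbsSums [Fintype V] [DecidableEq V]
    (c : TopEdgeLabeling V ℤˣ) (hV : 3 ≤ Fintype.card V) :
    ∃ k ∈ hamiltonianAbsSums c, (Fintype.card V : ℤ) ≤ 3 * k + 6 := by
  obtain ⟨ε, l, hl, hchain, hlen⟩ := exists_monochromatic_path c (by omega)
  match l, hl, hchain, hlen with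
  | [], _, _, hlen => simp at hlen; omega
  | u :: l, hl, hchain, hlen =>
    obtain ⟨v, q, hq⟩ := exists_walk_support_eq _ u l hchain
    have hpath : q.IsPath := by rwa [Walk.isPath_def, hq]
    obtain ⟨a, C, hC, hqC⟩ := exists_isHamiltonianCycle_of_isPath hV q hpath
    refine ⟨_, ⟨a, C, hC, rfl⟩, ?_⟩
    have h := two_mul_length_le_abs_labelSum c q hpath C hC hqC
    have h' := q.length_support
    rw [hq] at h'
    omega

lemma bddAbove_hamiltonianAbsSums [Fintype V] [DecidableEq V] (c : TopEdgeLabeling V ℤˣ) :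
    ∃ b : ℤ, ∀ k ∈ hamiltonianAbsSums c, k ≤ b := by
  refine ⟨Fintype.card (⊤ : SimpleGraph V).edgeSet, ?_⟩
  rintro k ⟨a, C, -, rfl⟩
  unfold labelSum
  refine (Finset.abs_sum_le_sum_abs _ _).trans ?_
  simp only [Int.isUnit_iff_abs_eq.1 (Units.isUnit _), Finset.sum_const, nsmul_eq_mul, mul_one]
  exact_mod_cast Finset.card_le_univ _

end HamiltonianDiscrepancy

open HamiltonianDiscrepancy in
theorem corollary1 :
    ∃ r : ℕ → ℝ, r =o[atTop] (fun n : ℕ => (n : ℝ)) ∧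
      ∀ (n : ℕ) (V : Type*) [Fintype V] [DecidableEq V], 4 ≤ n → Fintype.card V = n →
        ∃ D : ℤ, IsHamiltonianDiscrepancy V D ∧ (3 - 2 * Real.sqrt 2) * (n : ℝ) - r n ≤ (D : ℝ) := by
  refine ⟨fun _ => 2, ?_, ?_⟩
  · exact isLittleO_const_left.2 (Or.inr (tendsto_norm_atTop_atTop.comp tendsto_natCast_atTop_atTop))
  intro n V _ _ hn hcard
  have hV : 3 ≤ Fintype.card V := by omega
  have hmax : ∀ c : SimpleGraph.TopEdgeLabeling V ℤˣ,
      ∃ m, IsGreatest (hamiltonianAbsSums c) m := by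
    intro c
    obtain ⟨k, hk, -⟩ := exists_card_le_hamiltonianAbsSums c hV
    obtain ⟨b, hb⟩ := bddAbove_hamiltonianAbsSums c
    obtain ⟨m, hm, hm'⟩ := Int.exists_greatest_of_bdd ⟨b, hb⟩ ⟨k, hk⟩
    exact ⟨m, hm, hm'⟩
  choose M hM using hmax
  have hlow : ∀ c, (n : ℤ) ≤ 3 * M c + 6 := by
    intro c
    obtain ⟨k, hk, hk'⟩ := exists_card_le_hamiltonianAbsSums c hV
    have := (hM c).2 hk
    omega
  obtain ⟨D, hD, hD'⟩ := Int.exists_least_of_bdd (P := (· ∈ Set.range M))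
    ⟨-2, by rintro _ ⟨c, rfl⟩; have := hlow c; omega⟩ ⟨_, ⟨fun _ => 1, rfl⟩⟩
  refine ⟨D, ⟨M, hM, hD, hD'⟩, ?_⟩
  obtain ⟨c, rfl⟩ := hD
  have h : (n : ℝ) ≤ 3 * M c + 6 := by exact_mod_cast hlow c
  have hsqrt : (4 / 3 : ℝ) ≤ Real.sqrt 2 := Real.le_sqrt_of_sq_le (by norm_num)
  have hn0 : (0 : ℝ) ≤ n := n.cast_nonneg
  -- `√2 ≥ 4 / 3` is exactly `3 - 2√2 ≤ 1 / 3`.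
  nlinarith [mul_nonneg (sub_nonneg.2 hsqrt) hn0]
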